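/- Let $D\in\mathbb N$ and let $X=\mathbb R^D\setminus\{0\}$ carry the metric $d(x,y)=\|x-y\|_\infty+\bigl|\|x\|_\infty^{-1}-\|y\|_\infty^{-1}\bigr|$ and its Borel $\sigma$-field. A measure $\mu$ on $X$ is boundedly finite, $\mu\in\mathcal M^\#(X)$, if $\mu(A)<\infty$ for all $d$-bounded measurable $A\subseteq X$, and $\mu_n\to\mu$ weak$^\#$ if $\int f\,d\mu_n\to\int f\,d\mu$ for every bounded continuous $f\colon X\to\mathbb R$ with $d$-bounded support. A Lévy triple is a triple $(b,C,\mu)$ with $b\in\mathbb R^D$, $C$ a symmetric positive semidefinite real $D\times D$ matrix, and $\mu\in\mathcal M^\#(X)$ with $\int(1\wedge\|x\|_\infty^2)\,\mu(dx)<\infty$; its exponent is $$\Psi_{b,C,\mu}(u)=i\,u^tb-\tfrac12u^tCu+\int_{\mathbb R^D\setminus\{0\}}\bigl(e^{iu^tx}-1-i\,u^tx\,\mathbf 1_{|x|\le1}\bigr)\,\mu(dx),\qquad u\in\mathbb R^D,$$ where $|x|$ is the Euclidean norm. An $\mathbb R^D$-valued random variable $Z$ is infinitely divisible if for every $n\ge1$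 it has the law of a sum of $n$ i.i.d. random variables, and $(b,C,\mu)$ is a Lévy triple of $Z$ if $\log\mathbb E[e^{iu^tZ}]=\Psi_{b,C,\mu}(u)$ for all $u$, with the continuous logarithm vanishing at $u=0$ (equivalently, $\mathbb E[e^{iu^tZ}]=e^{\Psi_{b,C,\mu}(u)}$ for all $u$). (i) The exponent determines the Lévy triple: if two Lévy triples have the same exponent, they are equal. In particular, an infinitely divisible random variable has at most one Lévy triple. (ii) If $Z_n$ $(n\in\mathbb N)$ and $Z$ are infinitely divisible $\mathbb R^D$-valued random variables with Lévy triples $(b_n,C_n,\mu_n)$ and $(b,C,\mu)$, and $Z_n\to Z$ in distribution, then $\mu_n\to\mu$ weak$^\#$. -/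

import Mathlib

open MeasureTheory ProbabilityTheory Filter Topology
open scoped ENNReal Matrix BoundedContinuousFunction RealInnerProductSpace

universe u v w

/-- A measure on a metric space is boundedly finite if it is finite on all bounded measurable
sets. -/
def BoundedlyFinite {X : Type*} [PseudoMetricSpace X] [MeasurableSpace X]
    (μ : Measure X) : Prop :=
  ∀ A : Set X, MeasurableSet A → Bornology.IsBounded A → μ A < ∞

/-- Weak-hash convergence: the integrals of all bounded continuous real functions with bounded
support converge. -/
def WeakHashTendsto {X : Type*} [PseudoMetricSpace X] [MeasurableSpace X]
    (μs : ℕ → Measure X) (μ : Measure X) : Prop :=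
  ∀ f : X →ᵇ ℝ, Bornology.IsBounded (tsupport f) →
    Tendsto (fun n => ∫ x, f x ∂(μs n)) atTop (𝓝 (∫ x, f x ∂μ))

/-- The set `ℝ^D ∖ {0}`. It is a type of its own, so that it carries the metric below and not the
one inherited from `ℝ^D`. -/
def PuncturedSpace (D : ℕ) : Type := {x : EuclideanSpace ℝ (Fin D) // x ≠ 0}

namespace PuncturedSpace

variable {D : ℕ}

/-- The underlying vector of a point of `ℝ^D ∖ {0}`. -/
def toVec (x : PuncturedSpace D) : EuclideanSpace ℝ (Fin D) := x.1

/-- The maximum norm of a point (the norm of `Fin D → ℝ` is the maximum norm). -/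
noncomputable def supNorm (x : PuncturedSpace D) : ℝ := ‖x.toVec.ofLp‖

/-- The metric `d(x, y) = ‖x - y‖_∞ + |‖x‖_∞⁻¹ - ‖y‖_∞⁻¹|` on `ℝ^D ∖ {0}`. -/
noncomputable instance : MetricSpace (PuncturedSpace D) where
  dist x y := ‖x.toVec.ofLp - y.toVec.ofLp‖ + |x.supNorm⁻¹ - y.supNorm⁻¹|
  dist_self x := by simp
  dist_comm x y := by rw [norm_sub_rev, abs_sub_comm]
  dist_triangle x y z := by
    have h1 := norm_sub_le_norm_sub_add_norm_sub x.toVec.ofLp y.toVec.ofLp z.toVec.ofLp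
    have h2 := abs_sub_le x.supNorm⁻¹ y.supNorm⁻¹ z.supNorm⁻¹
    linarith
  eq_of_dist_eq_zero {x y} h := by
    have h1 := norm_nonneg (x.toVec.ofLp - y.toVec.ofLp)
    have h2 := abs_nonneg (x.supNorm⁻¹ - y.supNorm⁻¹)
    have h3 : ‖x.toVec.ofLp - y.toVec.ofLp‖ = 0 := by linarith
    exact Subtype.ext (WithLp.ofLp_injective 2 (sub_eq_zero.1 (norm_eq_zero.1 h3)))

/-- The Borel σ-field of the metric. -/
noncomputable instance : MeasurableSpace (PuncturedSpace D) := borel _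

instance : BorelSpace (PuncturedSpace D) := ⟨rfl⟩

end PuncturedSpace

/-- A Lévy triple `(b, C, μ)` on `ℝ^D`: a vector `b`, a symmetric positive semidefinite matrix `C`
and a boundedly finite measure `μ` on `ℝ^D ∖ {0}` with `∫ 1 ∧ ‖x‖_∞² μ(dx) < ∞`. -/
@[ext]
structure LevyTriple (D : ℕ) where
  b : EuclideanSpace ℝ (Fin D)
  C : Matrix (Fin D) (Fin D) ℝ
  μ : Measure (PuncturedSpace D)
  posSemidef : C.PosSemidef
  boundedlyFinite : BoundedlyFinite μ
  lintegral_lt_top : ∫⁻ x, ENNReal.ofReal (min 1 (x.supNorm ^ 2)) ∂μ < ∞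

open Classical in
/-- The right-hand side of the Lévy-Khintchine formula,
`i uᵗb - uᵗCu / 2 + ∫ (exp(i uᵗx) - 1 - i uᵗx 1_{|x| ≤ 1}) μ(dx)`, with `|x|` Euclidean. -/
noncomputable def LevyTriple.exponent {D : ℕ} (T : LevyTriple D)
    (u : EuclideanSpace ℝ (Fin D)) : ℂ :=
  Complex.I * ((⟪u, T.b⟫ : ℝ) : ℂ)
    - (1 / 2 : ℂ) * ((u.ofLp ⬝ᵥ (T.C *ᵥ u.ofLp) : ℝ) : ℂ)
    + ∫ x : PuncturedSpace D,
        (Complex.exp (Complex.I * ((⟪u, x.toVec⟫ : ℝ) : ℂ)) - 1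
          - Complex.I * ((⟪u, x.toVec⟫ : ℝ) : ℂ) * (if ‖x.toVec‖ ≤ 1 then 1 else 0)) ∂T.μ

/-- A random vector `Z` is infinitely divisible if for every `n ≥ 1` there are (on some probability
space) i.i.d. random vectors `Y 0, …, Y (n - 1)` whose sum has the law of `Z`. -/
def IsInfinitelyDivisible {D : ℕ} {Ω : Type*} [MeasurableSpace Ω]
    (Z : Ω → EuclideanSpace ℝ (Fin D)) (P : Measure Ω) : Prop :=
  ∀ n : ℕ, 1 ≤ n → ∃ (Ω' : Type) (_ : MeasurableSpace Ω') (P' : Measure Ω')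
    (Y : Fin n → Ω' → EuclideanSpace ℝ (Fin D)),
    IsProbabilityMeasure P' ∧ iIndepFun Y P' ∧ (∀ i j, IdentDistrib (Y i) (Y j) P' P') ∧
      IdentDistrib Z (fun ω => ∑ i, Y i ω) P P'

/-- `T` is a Lévy triple of the random vector `Z`: the Lévy-Khintchine formula
`log E[exp(i uᵗZ)] = T.exponent u` holds for all `u`. The logarithm of the nonvanishing
characteristic function is its continuous logarithm vanishing at `u = 0`; since `T.exponent` is
continuous and vanishes at `0`, this says that the exponential of `T.exponent u` is
`E[exp(i uᵗZ)]`. -/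
def LevyTriple.IsTripleOf {D : ℕ} (T : LevyTriple D) {Ω : Type*} [MeasurableSpace Ω]
    (Z : Ω → EuclideanSpace ℝ (Fin D)) (P : Measure Ω) : Prop :=
  ∀ u : EuclideanSpace ℝ (Fin D), charFun (P.map Z) u = Complex.exp (T.exponent u)

/-! The second difference `Ψ(u) - (Ψ(u+h) + Ψ(u-h))/2` kills the drift and the compensator, both
linear in `u`. As a function of `u` it is the characteristic function of the finite measure `ρ_h =
(hᵗCh/2) δ₀ + (1 - cos⟪h,x⟫) μ(dx)`. So equal exponents give equal `ρ_h`, and pointwise convergent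
exponents give weakly convergent `ρ_h`, by Lévy's continuity theorem. To recover `μ`, sum over `h =
(π/R) e_j`: the resulting weight is positive on `0 < ‖x‖_∞ ≤ R` and can be divided out, while the
atom at `0` is invisible to functions vanishing there. Once `μ` is known, the real and imaginary
parts of `Ψ` give `C` and `b`.

Convergence in distribution only controls `exp Ψ`. Tightness makes the convergence uniform along
each segment from `0` to `u`, and uniqueness of continuous lifts through `exp` then yields
convergence of `Ψ` itself (`tendsto_one_of_tendstoUniformly_exp`). -/

/-! ### Continuous logarithms along paths -/

theorem Complex.isLocallyInjective_exp : IsLocallyInjective Complex.exp :=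
  (Complex.isCoveringMap_exp.isLocalHomeomorph.isLocallyInjective.comp_left
    Subtype.val_injective :)

/-- If the exponentials of continuous paths starting at `0` converge uniformly, then so do the
endpoints of the paths. -/
theorem tendsto_one_of_tendstoUniformly_exp {ψs : ℕ → unitInterval → ℂ} {ψ : unitInterval → ℂ}
    (hψs : ∀ n, Continuous (ψs n)) (hψ : Continuous ψ) (hψs0 : ∀ n, ψs n 0 = 0) (hψ0 : ψ 0 = 0)
    (h : TendstoUniformly (fun n t => Complex.exp (ψs n t)) (fun t => Complex.exp (ψ t)) atTop) :
    Tendsto (fun n => ψs n 1) atTop (𝓝 (ψ 1)) := by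
  obtain ⟨c, hc, hcψ⟩ : ∃ c : ℝ, 0 < c ∧ ∀ t, c ≤ ‖Complex.exp (ψ t)‖ := by
    obtain ⟨t, -, ht⟩ := isCompact_univ.exists_isMinOn (s := (Set.univ : Set unitInterval))
      Set.univ_nonempty (f := fun t => ‖Complex.exp (ψ t)‖) (by fun_prop)
    exact ⟨_, norm_pos_iff.2 (Complex.exp_ne_zero (ψ t)), fun s => ht (Set.mem_univ s)⟩
  -- The quotient of the exponentials eventually stays in the unit disc about `1`, where the
  -- principal logarithm is continuous.
  have hev : ∀ᶠ n in atTop, ∀ t, ‖Complex.exp (ψs n t - ψ t) - 1‖ < 1 := by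
    filter_upwards [Metric.tendstoUniformly_iff.1 h c hc] with n hn t
    have h1 : Complex.exp (ψs n t - ψ t) - 1
        = (Complex.exp (ψs n t) - Complex.exp (ψ t)) / Complex.exp (ψ t) := by
      rw [Complex.exp_sub, sub_div, div_self (Complex.exp_ne_zero _)]
    rw [h1, norm_div, div_lt_one (norm_pos_iff.2 (Complex.exp_ne_zero _))]
    have := hn t
    rw [dist_comm, dist_eq_norm] at this
    exact this.trans_le (hcψ t)
  have hlog : ∀ᶠ n in atTop, ψs n 1 - ψ 1 = Complex.log (Complex.exp (ψs n 1 - ψ 1)) := by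
    filter_upwards [hev] with n hn
    have hslit : ∀ t, Complex.exp (ψs n t - ψ t) ∈ Complex.slitPlane := fun t => by
      have := Complex.mem_slitPlane_of_norm_lt_one (hn t)
      simpa using this
    have hcont : Continuous fun t => ψs n t - ψ t := (hψs n).sub hψ
    -- Both sides are continuous lifts of the same path through `exp` and agree at `0`, so no
    -- multiple of `2πi` can appear.
    refine congrFun ((T2Space.isSeparatedMap Complex.exp).eq_of_comp_eq
      Complex.isLocallyInjective_exp hcont
      (g₂ := fun t => Complex.log (Complex.exp (ψs n t - ψ t))) ?_ ?_ 0 ?_) 1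
    · exact (Complex.continuous_exp.comp hcont).clog hslit
    · ext t
      simp [Complex.exp_log (Complex.exp_ne_zero _)]
    · simp [hψs0, hψ0]
  have hlim : Tendsto (fun n => Complex.exp (ψs n 1 - ψ 1)) atTop (𝓝 1) := by
    have := (h.tendsto_at 1).div_const (Complex.exp (ψ 1))
    simpa [Complex.exp_sub, Complex.exp_ne_zero] using this
  have h2 := hlim.clog (by simp)
  rw [Complex.log_one] at h2
  have h3 := (h2.congr' (hlog.mono fun n hn => hn.symm)).add_const (ψ 1)
  simpa using h3

/-! ### Equicontinuity of characteristic functions and Lévy's continuity theorem -/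

section Levy

variable {E : Type*} [NormedAddCommGroup E] [InnerProductSpace ℝ E] [FiniteDimensional ℝ E]
  [MeasurableSpace E] [BorelSpace E]

/-- Inside radius `R`, `|e^{is} - 1| ≤ |s|` and Cauchy–Schwarz bound the integrand; outside, it is
at most `2`. -/
theorem norm_charFun_sub_le (μ : Measure E) [IsProbabilityMeasure μ] {R ε : ℝ}
    (h : μ.real {x | R < ‖x‖} ≤ ε) (hR : 0 ≤ R) (u v : E) :
    ‖charFun μ u - charFun μ v‖ ≤ ‖u - v‖ * R + 2 * ε := by
  have hint : ∀ u : E, Integrable (fun x => Complex.exp ((⟪x, u⟫ : ℝ) * Complex.I)) μ := fun u => by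
    refine (integrable_const (1 : ℝ)).mono' (by fun_prop) (ae_of_all _ fun x => ?_)
    rw [Complex.norm_exp_ofReal_mul_I]
  have hms : MeasurableSet {x : E | R < ‖x‖} := measurableSet_lt measurable_const measurable_norm
  rw [charFun_apply, charFun_apply, ← integral_sub (hint u) (hint v)]
  calc _ ≤ ∫ x, (‖u - v‖ * R + 2 * Set.indicator {x : E | R < ‖x‖} 1 x) ∂μ := by
        refine norm_integral_le_of_norm_le ?_ (ae_of_all _ fun x => ?_)
        · exact (integrable_const _).add (((integrable_const 1).indicator hms).const_mul 2)
        · by_cases hx : R < ‖x‖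
          · rw [Set.indicator_of_mem (by exact hx)]
            have := norm_sub_le (Complex.exp ((⟪x, u⟫ : ℝ) * Complex.I))
              (Complex.exp ((⟪x, v⟫ : ℝ) * Complex.I))
            rw [Complex.norm_exp_ofReal_mul_I, Complex.norm_exp_ofReal_mul_I] at this
            have : 0 ≤ ‖u - v‖ * R := by positivity
            simp only [Pi.one_apply]
            linarith
          · rw [Set.indicator_of_notMem (by exact hx)]
            have h1 : Complex.exp ((⟪x, u⟫ : ℝ) * Complex.I) - Complex.exp ((⟪x, v⟫ : ℝ) * Complex.I)
                = Complex.exp ((⟪x, v⟫ : ℝ) * Complex.I)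
                  * (Complex.exp (Complex.I * (⟪x, u - v⟫ : ℝ)) - 1) := by
              rw [mul_sub, ← Complex.exp_add, inner_sub_right]
              push_cast
              ring_nf
            rw [h1, norm_mul, Complex.norm_exp_ofReal_mul_I, one_mul]
            have h2 := Real.norm_exp_I_mul_ofReal_sub_one_le (x := ⟪x, u - v⟫)
            have h3 := norm_inner_le_norm (𝕜 := ℝ) x (u - v)
            have h4 : ‖x‖ * ‖u - v‖ ≤ R * ‖u - v‖ := by gcongr; exact not_lt.1 hx
            linarith
    _ = ‖u - v‖ * R + 2 * μ.real {x | R < ‖x‖} := by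
        rw [integral_add (integrable_const _) (((integrable_const 1).indicator hms).const_mul 2),
          integral_const_mul 2, integral_indicator_one hms]
        simp
    _ ≤ _ := by linarith

theorem uniformEquicontinuous_charFun_of_isTightMeasureSet {μs : ℕ → Measure E}
    [∀ n, IsProbabilityMeasure (μs n)] (h : IsTightMeasureSet (Set.range μs)) :
    UniformEquicontinuous fun n => charFun (μs n) := by
  rw [Metric.uniformEquicontinuous_iff]
  intro ε hε
  have h1 := (tendsto_measure_norm_gt_of_isTightMeasureSet h).eventually
    (ge_mem_nhds (ENNReal.ofReal_pos.2 (show 0 < ε / 8 by positivity)))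
  obtain ⟨R, hR, hR0⟩ := (h1.and (eventually_gt_atTop 0)).exists
  refine ⟨ε / (2 * R), by positivity, fun u v huv n => ?_⟩
  have h2 : (μs n).real {x | R < ‖x‖} ≤ ε / 8 := by
    refine ENNReal.toReal_le_of_le_ofReal (by positivity) (le_trans ?_ hR)
    exact le_iSup₂ (f := fun μ (_ : μ ∈ Set.range μs) => μ {x : E | R < ‖x‖}) (μs n) ⟨n, rfl⟩
  have h3 := norm_charFun_sub_le (μs n) h2 hR0.le u v
  rw [dist_eq_norm] at huv ⊢
  rw [lt_div_iff₀ (by positivity)] at huv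
  linarith

/-- A pointwise limit that is continuous at `0` forces tightness, hence equicontinuity; on a compact
segment pointwise convergence is then uniform. -/
theorem tendstoUniformly_charFun_path {μs : ℕ → Measure E} [∀ n, IsProbabilityMeasure (μs n)]
    {μ : Measure E} [IsProbabilityMeasure μ]
    (h : ∀ u, Tendsto (fun n => charFun (μs n) u) atTop (𝓝 (charFun μ u))) (u : E) :
    TendstoUniformly (fun n (t : unitInterval) => charFun (μs n) ((t : ℝ) • u))
      (fun t => charFun μ ((t : ℝ) • u)) atTop := by
  have h1 := (uniformEquicontinuous_charFun_of_isTightMeasureSet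
    (isTightMeasureSet_of_tendsto_charFun continuous_charFun.continuousAt h)).equicontinuous
  have h2 : Equicontinuous fun n (t : unitInterval) => charFun (μs n) ((t : ℝ) • u) := fun t => by
    have hc : Continuous fun t : unitInterval => (t : ℝ) • u := by fun_prop
    intro U hU
    exact (hc.tendsto t).eventually (h1 _ U hU)
  have h3 := (h2.tendsto_uniformFun_iff_pi atTop (fun t => charFun μ ((t : ℝ) • u))).2
    (tendsto_pi_nhds.2 fun t => h _)
  exact UniformFun.tendsto_iff_tendstoUniformly.1 h3

/-- The Lévy continuity theorem for finite measures. -/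
theorem MeasureTheory.FiniteMeasure.tendsto_of_tendsto_charFun {μs : ℕ → FiniteMeasure E}
    {μ : FiniteMeasure E}
    (h : ∀ u, Tendsto (fun n => charFun (μs n : Measure E) u) atTop
      (𝓝 (charFun (μ : Measure E) u))) :
    Tendsto μs atTop (𝓝 μ) := by
  have hmass' : Tendsto (fun n => ((μs n).mass : ℝ)) atTop (𝓝 (μ.mass : ℝ)) := by
    have h0 := (Complex.continuous_re.tendsto _).comp (h 0)
    simpa [charFun_zero, Function.comp_def] using h0
  have hmass := NNReal.tendsto_coe.1 hmass'
  -- A zero limit cannot be normalized, but then convergence of the masses suffices.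
  rcases eq_or_ne μ 0 with rfl | hμ
  · exact FiniteMeasure.tendsto_zero_of_tendsto_zero_mass (by simpa using hmass)
  refine FiniteMeasure.tendsto_of_tendsto_normalize_testAgainstNN_of_tendsto_mass ?_ hmass
  refine ProbabilityMeasure.tendsto_of_tendsto_charFun fun u => ?_
  have hne : μ.mass ≠ 0 := fun h0 => hμ ((FiniteMeasure.mass_zero_iff μ).1 h0)
  have key : ∀ ν : FiniteMeasure E, ν ≠ 0 →
      charFun (ν.normalize : Measure E) u = ((ν.mass : ℝ) : ℂ)⁻¹ * charFun (ν : Measure E) u := by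
    intro ν hν
    rw [ν.toMeasure_normalize_eq_of_nonzero hν, charFun_apply, charFun_apply,
      integral_smul_nnreal_measure]
    simp [NNReal.smul_def]
  rw [key μ hμ]
  have hev : ∀ᶠ n in atTop, μs n ≠ 0 := by
    filter_upwards [hmass.eventually_ne hne] with n hn h0
    exact hn (by simp [h0])
  refine Tendsto.congr' (hev.mono fun n hn => (key _ hn).symm) (Tendsto.mul ?_ (h u))
  exact (((Complex.continuous_ofReal.tendsto _).comp hmass').inv₀ (by simpa using hne))

end Levy

/-! ### Topology and bounded sets of the punctured space -/

namespace PuncturedSpace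

variable {D : ℕ}

theorem dist_def (x y : PuncturedSpace D) :
    dist x y = ‖x.toVec.ofLp - y.toVec.ofLp‖ + |x.supNorm⁻¹ - y.supNorm⁻¹| := rfl

theorem toVec_ne_zero (x : PuncturedSpace D) : x.toVec ≠ 0 := x.2

theorem supNorm_pos (x : PuncturedSpace D) : 0 < x.supNorm :=
  norm_pos_iff.2 fun h => x.2 (WithLp.ofLp_injective 2 h)

theorem continuous_toVec : Continuous (toVec : PuncturedSpace D → EuclideanSpace ℝ (Fin D)) := by
  have h : LipschitzWith 1 fun x : PuncturedSpace D => x.toVec.ofLp :=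
    LipschitzWith.of_dist_le_mul fun x y => by
      rw [dist_eq_norm, dist_def, NNReal.coe_one, one_mul]
      exact le_add_of_nonneg_right (abs_nonneg _)
  exact (PiLp.continuous_toLp 2 _).comp h.continuous

/-- The metric of `ℝ^D ∖ {0}` induces the subspace topology. -/
def homeomorphSubtype (D : ℕ) : PuncturedSpace D ≃ₜ {x : EuclideanSpace ℝ (Fin D) // x ≠ 0} where
  toFun x := ⟨x.toVec, x.2⟩
  invFun x := x
  left_inv _ := rfl
  right_inv _ := rfl
  continuous_toFun := continuous_toVec.subtype_mk _
  continuous_invFun := by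
    refine continuous_iff_continuousAt.2 fun x => ?_
    refine tendsto_iff_dist_tendsto_zero.2 ?_
    have hx : ‖x.1.ofLp‖ ≠ 0 := norm_ne_zero_iff.2 fun h => x.2 (WithLp.ofLp_injective 2 h)
    have h1 : Continuous fun y : {x : EuclideanSpace ℝ (Fin D) // x ≠ 0} => y.1.ofLp :=
      (PiLp.continuous_ofLp 2 _).comp continuous_subtype_val
    have h2 : ContinuousAt (fun y : {x : EuclideanSpace ℝ (Fin D) // x ≠ 0} =>
        ‖y.1.ofLp - x.1.ofLp‖ + |‖y.1.ofLp‖⁻¹ - ‖x.1.ofLp‖⁻¹|) x :=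
      (h1.continuousAt.sub continuousAt_const).norm.add
        ((h1.continuousAt.norm.inv₀ hx).sub continuousAt_const).abs
    have h3 := h2.tendsto
    rw [sub_self, sub_self, norm_zero, abs_zero, add_zero] at h3
    exact h3

theorem isOpenEmbedding_toVec :
    IsOpenEmbedding (toVec : PuncturedSpace D → EuclideanSpace ℝ (Fin D)) :=
  (isOpen_ne.isOpenEmbedding_subtypeVal).comp (homeomorphSubtype D).isOpenEmbedding

theorem measurableEmbedding_toVec :
    MeasurableEmbedding (toVec : PuncturedSpace D → EuclideanSpace ℝ (Fin D)) :=
  isOpenEmbedding_toVec.measurableEmbedding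

theorem continuous_supNorm : Continuous (supNorm : PuncturedSpace D → ℝ) :=
  ((PiLp.continuous_ofLp 2 _).comp continuous_toVec).norm

theorem abs_toVec_apply_le (x : PuncturedSpace D) (j : Fin D) : |x.toVec j| ≤ x.supNorm :=
  norm_le_pi_norm x.toVec.ofLp j

/-- The inverse-norm term of the metric keeps bounded sets away from the origin. -/
theorem exists_bound_of_isBounded {s : Set (PuncturedSpace D)} (hs : Bornology.IsBounded s) :
    ∃ R : ℝ, 0 < R ∧ ∀ x ∈ s, x.supNorm ≤ R ∧ R⁻¹ ≤ x.supNorm := by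
  rcases s.eq_empty_or_nonempty with rfl | ⟨y, hy⟩
  · exact ⟨1, one_pos, by simp⟩
  obtain ⟨M, hM⟩ := Metric.isBounded_iff.1 hs
  have hM0 : 0 ≤ M := dist_nonneg.trans (hM hy hy)
  have hy0 := y.supNorm_pos
  have hy1 := inv_pos.2 hy0
  refine ⟨y.supNorm + y.supNorm⁻¹ + M, by positivity, fun x hx => ?_⟩
  have h1 := hM hx hy
  rw [dist_def] at h1
  have h2 : x.supNorm ≤ y.supNorm + ‖x.toVec.ofLp - y.toVec.ofLp‖ := norm_le_norm_add_norm_sub' _ _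
  have h3 := le_abs_self (x.supNorm⁻¹ - y.supNorm⁻¹)
  have h4 := norm_nonneg (x.toVec.ofLp - y.toVec.ofLp)
  have h5 := abs_nonneg (x.supNorm⁻¹ - y.supNorm⁻¹)
  exact ⟨by linarith, inv_le_of_inv_le₀ x.supNorm_pos (by linarith)⟩

theorem norm_toVec_sq_le (x : PuncturedSpace D) : ‖x.toVec‖ ^ 2 ≤ D * x.supNorm ^ 2 := by
  rw [EuclideanSpace.norm_sq_eq]
  calc ∑ i, ‖x.toVec i‖ ^ 2 ≤ ∑ _i : Fin D, x.supNorm ^ 2 := by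
        gcongr with i
        exact x.abs_toVec_apply_le i
    _ = _ := by simp

end PuncturedSpace

/-! ### Integrability and the Lévy–Khintchine kernel -/

namespace LevyTriple

variable {D : ℕ} (T : LevyTriple D)

theorem integrable_min_one_norm_sq :
    Integrable (fun x : PuncturedSpace D => min 1 (‖x.toVec‖ ^ 2)) T.μ := by
  have hc := PuncturedSpace.continuous_toVec (D := D)
  have hs := PuncturedSpace.continuous_supNorm (D := D)
  have h1 : Integrable (fun x : PuncturedSpace D => min 1 (x.supNorm ^ 2)) T.μ := by
    refine ⟨(by fun_prop : Continuous _).aestronglyMeasurable, ?_⟩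
    rw [hasFiniteIntegral_iff_ofReal (ae_of_all _ fun x => by positivity)]
    exact T.lintegral_lt_top
  refine (h1.const_mul (D + 1)).mono' (by fun_prop : Continuous _).aestronglyMeasurable
    (ae_of_all _ fun x => ?_)
  rw [Real.norm_of_nonneg (by positivity)]
  have h2 := x.norm_toVec_sq_le
  have h3 : (0 : ℝ) ≤ D := by positivity
  rcases le_total 1 (x.supNorm ^ 2) with h | h
  · rw [min_eq_left h]
    exact (min_le_left _ _).trans (by linarith)
  · rw [min_eq_right h]
    exact (min_le_right _ _).trans (by nlinarith [sq_nonneg x.supNorm])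

end LevyTriple

theorem norm_exp_I_mul_sub_one_sub_le_sq (s : ℝ) :
    ‖Complex.exp (Complex.I * s) - 1 - Complex.I * s‖ ≤ 3 * s ^ 2 := by
  have hn : ‖Complex.I * (s : ℂ)‖ = |s| := by simp
  rcases le_total |s| 1 with h | h
  · have := Complex.norm_exp_sub_one_sub_id_le (hn.trans_le h)
    rw [hn, sq_abs] at this
    nlinarith [sq_nonneg s]
  · have h1 := norm_sub_le (Complex.exp (Complex.I * s) - 1) (Complex.I * s)
    have h2 := Real.norm_exp_I_mul_ofReal_sub_one_le (x := s)
    rw [hn] at h1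
    rw [Real.norm_eq_abs] at h2
    nlinarith [sq_abs s]

open Classical in
/-- The integrand of the Lévy-Khintchine formula. -/
noncomputable def levyKernel {D : ℕ} (u x : EuclideanSpace ℝ (Fin D)) : ℂ :=
  Complex.exp (Complex.I * ((⟪u, x⟫ : ℝ) : ℂ)) - 1
    - Complex.I * ((⟪u, x⟫ : ℝ) : ℂ) * (if ‖x‖ ≤ 1 then 1 else 0)

section Kernel

variable {D : ℕ}

theorem abs_inner_sq_le {u x : EuclideanSpace ℝ (Fin D)} :
    (⟪u, x⟫ : ℝ) ^ 2 ≤ ‖u‖ ^ 2 * ‖x‖ ^ 2 := by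
  rw [← mul_pow, ← sq_abs]
  gcongr
  exact abs_real_inner_le_norm u x

theorem norm_levyKernel_le (u x : EuclideanSpace ℝ (Fin D)) :
    ‖levyKernel u x‖ ≤ (3 * ‖u‖ ^ 2 + 2) * min 1 (‖x‖ ^ 2) := by
  rw [levyKernel]
  split_ifs with hx
  · rw [mul_one, min_eq_right (pow_le_one₀ (norm_nonneg x) hx)]
    have h1 := norm_exp_I_mul_sub_one_sub_le_sq ⟪u, x⟫
    have h2 := abs_inner_sq_le (u := u) (x := x)
    nlinarith [sq_nonneg ‖x‖]
  · rw [mul_zero, sub_zero, min_eq_left (one_le_pow₀ (not_le.1 hx).le)]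
    have h1 := norm_sub_le (Complex.exp (Complex.I * (⟪u, x⟫ : ℝ))) 1
    rw [Complex.norm_exp_I_mul_ofReal, norm_one] at h1
    nlinarith [sq_nonneg ‖u‖]

theorem one_sub_cos_inner_nonneg (h x : EuclideanSpace ℝ (Fin D)) : 0 ≤ 1 - Real.cos ⟪h, x⟫ :=
  sub_nonneg.2 (Real.cos_le_one _)

theorem one_sub_cos_inner_le (h x : EuclideanSpace ℝ (Fin D)) :
    1 - Real.cos ⟪h, x⟫ ≤ (‖h‖ ^ 2 + 2) * min 1 (‖x‖ ^ 2) := by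
  have h1 := Real.one_sub_sq_div_two_le_cos (x := ⟪h, x⟫)
  have h2 := abs_inner_sq_le (u := h) (x := x)
  have h3 := Real.neg_one_le_cos ⟪h, x⟫
  rcases le_total 1 (‖x‖ ^ 2) with hx | hx
  · rw [min_eq_left hx]
    nlinarith [sq_nonneg ‖h‖]
  · rw [min_eq_right hx]
    nlinarith [sq_nonneg ‖x‖, mul_nonneg (sq_nonneg ‖h‖) (sq_nonneg ‖x‖)]

theorem measurable_levyKernel (u : EuclideanSpace ℝ (Fin D)) : Measurable (levyKernel u) := by
  unfold levyKernel
  refine Measurable.sub (by fun_prop) (Measurable.mul (by fun_prop) ?_)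
  exact Measurable.ite (measurableSet_le measurable_norm measurable_const)
    measurable_const measurable_const

theorem continuous_levyKernel_left (x : EuclideanSpace ℝ (Fin D)) :
    Continuous fun u => levyKernel u x := by
  unfold levyKernel
  fun_prop

/-- Averaging over `±h` multiplies the exponential by `cos⟪h,x⟫` and leaves the terms affine in `u`
unchanged, so the truncation disappears. -/
theorem levyKernel_second_difference (u h x : EuclideanSpace ℝ (Fin D)) :
    levyKernel u x - (levyKernel (u + h) x + levyKernel (u - h) x) / 2
      = Complex.exp (Complex.I * (⟪u, x⟫ : ℝ)) * ((1 - Real.cos ⟪h, x⟫ : ℝ) : ℂ) := by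
  simp only [levyKernel, inner_add_left, inner_sub_left]
  push_cast
  rw [Complex.cos, mul_add, mul_sub, Complex.exp_add, Complex.exp_sub,
    show -((⟪h, x⟫ : ℝ) : ℂ) * Complex.I = -(Complex.I * (⟪h, x⟫ : ℝ)) by ring, Complex.exp_neg,
    mul_comm ((⟪h, x⟫ : ℝ) : ℂ)]
  ring

end Kernel

/-! ### Continuity and second differences of the exponent -/

namespace LevyTriple

variable {D : ℕ} (T : LevyTriple D)

theorem exponent_eq (u : EuclideanSpace ℝ (Fin D)) :
    T.exponent u = Complex.I * ((⟪u, T.b⟫ : ℝ) : ℂ)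
      - (1 / 2 : ℂ) * ((u.ofLp ⬝ᵥ (T.C *ᵥ u.ofLp) : ℝ) : ℂ) + ∫ x, levyKernel u x.toVec ∂T.μ := rfl

theorem aestronglyMeasurable_levyKernel (u : EuclideanSpace ℝ (Fin D)) :
    AEStronglyMeasurable (fun x : PuncturedSpace D => levyKernel u x.toVec) T.μ :=
  ((measurable_levyKernel u).comp
    PuncturedSpace.continuous_toVec.measurable).aestronglyMeasurable

theorem integrable_levyKernel (u : EuclideanSpace ℝ (Fin D)) :
    Integrable (fun x : PuncturedSpace D => levyKernel u x.toVec) T.μ :=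
  (T.integrable_min_one_norm_sq.const_mul _).mono' (T.aestronglyMeasurable_levyKernel u)
    (ae_of_all _ fun x => norm_levyKernel_le u x.toVec)

theorem integrable_one_sub_cos (h : EuclideanSpace ℝ (Fin D)) :
    Integrable (fun x : PuncturedSpace D => 1 - Real.cos ⟪h, x.toVec⟫) T.μ := by
  have hc := PuncturedSpace.continuous_toVec (D := D)
  refine (T.integrable_min_one_norm_sq.const_mul (‖h‖ ^ 2 + 2)).mono'
    (by fun_prop : Continuous _).aestronglyMeasurable (ae_of_all _ fun x => ?_)
  rw [Real.norm_of_nonneg (one_sub_cos_inner_nonneg _ _)]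
  exact one_sub_cos_inner_le h x.toVec

/-- Dominated convergence, with a bound uniform over `‖u‖ ≤ ‖u₀‖ + 1`. Continuity makes the exponent
a lift through `exp` along segments. -/
theorem continuous_exponent : Continuous T.exponent := by
  have h : Continuous fun u => ∫ x, levyKernel u (PuncturedSpace.toVec x) ∂T.μ := by
    refine continuous_iff_continuousAt.2 fun u₀ => ?_
    refine continuousAt_of_dominated
      (bound := fun x => (3 * (‖u₀‖ + 1) ^ 2 + 2) * min 1 (‖x.toVec‖ ^ 2))
      (Eventually.of_forall fun u => T.aestronglyMeasurable_levyKernel u) ?_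
      (T.integrable_min_one_norm_sq.const_mul _)
      (ae_of_all _ fun x => (continuous_levyKernel_left x.toVec).continuousAt)
    filter_upwards [continuous_norm.continuousAt.eventually_le_const
      (show ‖u₀‖ < ‖u₀‖ + 1 by linarith)] with u hu
    refine ae_of_all _ fun x => (norm_levyKernel_le u x.toVec).trans ?_
    gcongr
  have h2 : Continuous fun u : EuclideanSpace ℝ (Fin D) => u.ofLp ⬝ᵥ (T.C *ᵥ u.ofLp) := by
    have h3 := PiLp.continuous_ofLp 2 (fun _ : Fin D => ℝ)
    exact h3.dotProduct (continuous_const.matrix_mulVec h3)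
  simp_rw [funext T.exponent_eq]
  fun_prop

@[simp]
theorem exponent_zero : T.exponent 0 = 0 := by
  simp [exponent_eq, levyKernel]

theorem exponent_second_difference (u h : EuclideanSpace ℝ (Fin D)) :
    T.exponent u - (T.exponent (u + h) + T.exponent (u - h)) / 2
      = ((h.ofLp ⬝ᵥ (T.C *ᵥ h.ofLp) / 2 : ℝ) : ℂ)
        + ∫ x : PuncturedSpace D, Complex.exp (Complex.I * (⟪u, x.toVec⟫ : ℝ))
          * ((1 - Real.cos ⟪h, x.toVec⟫ : ℝ) : ℂ) ∂T.μ := by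
  simp_rw [← levyKernel_second_difference]
  have h1 := T.integrable_levyKernel (u + h)
  have h2 := T.integrable_levyKernel (u - h)
  have h3 : Integrable (fun x : PuncturedSpace D =>
      (levyKernel (u + h) x.toVec + levyKernel (u - h) x.toVec) / 2) T.μ := (h1.add h2).div_const 2
  rw [integral_sub (T.integrable_levyKernel u) h3, integral_div, integral_add h1 h2]
  simp only [exponent_eq, inner_add_left, inner_sub_left, WithLp.ofLp_add, WithLp.ofLp_sub,
    Matrix.mulVec_add, Matrix.mulVec_sub, dotProduct_add, dotProduct_sub, add_dotProduct,
    sub_dotProduct]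
  push_cast
  ring

end LevyTriple

/-! ### The finite measures behind the second differences -/

namespace LevyTriple

variable {D : ℕ} (T : LevyTriple D)

theorem quadraticForm_nonneg (h : EuclideanSpace ℝ (Fin D)) :
    0 ≤ h.ofLp ⬝ᵥ (T.C *ᵥ h.ofLp) := by
  simpa using T.posSemidef.dotProduct_mulVec_nonneg h.ofLp

/-- The finite measure `hᵗCh / 2 • δ₀ + (1 - cos ⟪h, x⟫) μ(dx)`, whose characteristic function is a
second difference of the exponent. -/
noncomputable def differenceMeasure (h : EuclideanSpace ℝ (Fin D)) :
    Measure (EuclideanSpace ℝ (Fin D)) :=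
  ENNReal.ofReal (h.ofLp ⬝ᵥ (T.C *ᵥ h.ofLp) / 2) • Measure.dirac 0
    + (T.μ.withDensity fun x => ENNReal.ofReal (1 - Real.cos ⟪h, x.toVec⟫)).map
        PuncturedSpace.toVec

theorem measurable_ofReal_one_sub_cos (h : EuclideanSpace ℝ (Fin D)) :
    Measurable fun x : PuncturedSpace D => ENNReal.ofReal (1 - Real.cos ⟪h, x.toVec⟫) := by
  have := PuncturedSpace.continuous_toVec (D := D)
  exact (by fun_prop : Continuous fun x : PuncturedSpace D =>
    1 - Real.cos ⟪h, x.toVec⟫).measurable.ennreal_ofReal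

theorem lintegral_differenceMeasure (h : EuclideanSpace ℝ (Fin D))
    {F : EuclideanSpace ℝ (Fin D) → ℝ≥0∞} (hF : Measurable F) :
    ∫⁻ y, F y ∂(T.differenceMeasure h)
      = ENNReal.ofReal (h.ofLp ⬝ᵥ (T.C *ᵥ h.ofLp) / 2) * F 0
        + ∫⁻ x, ENNReal.ofReal (1 - Real.cos ⟪h, x.toVec⟫) * F x.toVec ∂T.μ := by
  have hm := PuncturedSpace.continuous_toVec (D := D).measurable
  rw [differenceMeasure, lintegral_add_measure, lintegral_smul_measure, lintegral_dirac' 0 hF,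
    lintegral_map hF hm]
  exact congrArg _ (lintegral_withDensity_eq_lintegral_mul _
    (measurable_ofReal_one_sub_cos h) (hF.comp hm))

theorem lintegral_one_sub_cos_lt_top (h : EuclideanSpace ℝ (Fin D)) :
    ∫⁻ x : PuncturedSpace D, ENNReal.ofReal (1 - Real.cos ⟪h, x.toVec⟫) ∂T.μ < ∞ := by
  have h0 : ∀ᵐ x : PuncturedSpace D ∂T.μ, 0 ≤ 1 - Real.cos ⟪h, x.toVec⟫ :=
    ae_of_all _ fun x => one_sub_cos_inner_nonneg h x.toVec
  rw [← hasFiniteIntegral_iff_ofReal h0]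
  exact (T.integrable_one_sub_cos h).hasFiniteIntegral

theorem differenceMeasure_univ_lt_top (h : EuclideanSpace ℝ (Fin D)) :
    T.differenceMeasure h Set.univ < ∞ := by
  rw [← setLIntegral_one, Measure.restrict_univ, T.lintegral_differenceMeasure h measurable_const]
  simp only [mul_one]
  exact ENNReal.add_lt_top.2 ⟨ENNReal.ofReal_lt_top, T.lintegral_one_sub_cos_lt_top h⟩

instance isFiniteMeasure_differenceMeasure (h : EuclideanSpace ℝ (Fin D)) :
    IsFiniteMeasure (T.differenceMeasure h) :=
  ⟨T.differenceMeasure_univ_lt_top h⟩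

theorem integral_differenceMeasure {G : Type*} [NormedAddCommGroup G] [NormedSpace ℝ G]
    [CompleteSpace G] (h : EuclideanSpace ℝ (Fin D)) {F : EuclideanSpace ℝ (Fin D) → G}
    (hF : Integrable F (T.differenceMeasure h)) :
    ∫ y, F y ∂(T.differenceMeasure h)
      = (h.ofLp ⬝ᵥ (T.C *ᵥ h.ofLp) / 2) • F 0
        + ∫ x, (1 - Real.cos ⟪h, x.toVec⟫) • F x.toVec ∂T.μ := by
  rw [differenceMeasure] at hF ⊢
  rw [integral_add_measure hF.left_of_add_measure hF.right_of_add_measure, integral_smul_measure,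
    integral_dirac, PuncturedSpace.measurableEmbedding_toVec.integral_map,
    integral_withDensity_eq_integral_toReal_smul (measurable_ofReal_one_sub_cos h)
      (ae_of_all _ fun _ => ENNReal.ofReal_lt_top),
    ENNReal.toReal_ofReal (div_nonneg (T.quadraticForm_nonneg h) two_pos.le)]
  simp_rw [ENNReal.toReal_ofReal (one_sub_cos_inner_nonneg h _)]

/-- By the parallelogram law the Gaussian part contributes the constant `hᵗCh/2`, the characteristic
function of an atom at `0`. -/
theorem charFun_differenceMeasure (h u : EuclideanSpace ℝ (Fin D)) :
    charFun (T.differenceMeasure h) u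
      = T.exponent u - (T.exponent (u + h) + T.exponent (u - h)) / 2 := by
  have hint : Integrable (fun y => Complex.exp ((⟪y, u⟫ : ℝ) * Complex.I))
      (T.differenceMeasure h) := by
    refine (integrable_const (1 : ℝ)).mono' (by fun_prop) (ae_of_all _ fun x => ?_)
    rw [Complex.norm_exp_ofReal_mul_I]
  rw [charFun_apply, T.integral_differenceMeasure h hint, exponent_second_difference]
  congr 1
  · simp
  · refine integral_congr_ae (ae_of_all _ fun x => ?_)
    simp only [Complex.real_smul]
    rw [mul_comm, mul_comm Complex.I, real_inner_comm]

end LevyTriple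

/-! ### A weight positive on punctured balls -/

section Weight

variable {D : ℕ}

/-- The vector `(π / R) e_j`. -/
noncomputable def frequencyVec (R : ℝ) (j : Fin D) : EuclideanSpace ℝ (Fin D) :=
  EuclideanSpace.single j (Real.pi / R)

/-- A sum of functions `1 - cos ⟪h, x⟫` that is positive for `0 < ‖x‖_∞ ≤ R`. -/
noncomputable def cosWeight (R : ℝ) (x : EuclideanSpace ℝ (Fin D)) : ℝ :=
  ∑ j, (1 - Real.cos ⟪frequencyVec R j, x⟫)

theorem continuous_cosWeight (R : ℝ) : Continuous (cosWeight R (D := D)) := by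
  unfold cosWeight
  fun_prop

/-- The angles `π x_j / R` lie in `[-π, π]`, where the cosine equals `1` only at `0`, and some `x_j`
is nonzero. -/
theorem cosWeight_pos {R : ℝ} (x : PuncturedSpace D) (hx : x.supNorm ≤ R) :
    0 < cosWeight R x.toVec := by
  have hR : 0 < R := x.supNorm_pos.trans_le hx
  obtain ⟨j, hj⟩ : ∃ j, x.toVec j ≠ 0 := by
    by_contra! h
    exact x.toVec_ne_zero (by ext j; simpa using h j)
  refine Finset.sum_pos' (fun i _ => one_sub_cos_inner_nonneg _ _) ⟨j, Finset.mem_univ j, ?_⟩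
  have h1 : |x.toVec j / R| ≤ 1 := by
    rw [abs_div, abs_of_pos hR, div_le_one hR]
    exact (x.abs_toVec_apply_le j).trans hx
  have h2 : (⟪frequencyVec R j, x.toVec⟫ : ℝ) = Real.pi * (x.toVec j / R) := by
    simp [frequencyVec, EuclideanSpace.inner_single_left]
    ring
  have hp := Real.pi_pos
  have h3 := abs_le.1 h1
  rw [h2, sub_pos]
  refine (Real.cos_le_one _).lt_of_ne fun h => ?_
  have h4 := (Real.cos_eq_one_iff_of_lt_of_lt (by nlinarith) (by nlinarith)).1 h
  exact (mul_ne_zero hp.ne' (div_ne_zero hj hR.ne')) h4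

end Weight

/-! ### Recovering the triple and passing to the limit -/

namespace LevyTriple

variable {D : ℕ}

theorem tendsto_integral_differenceMeasure {Ts : ℕ → LevyTriple D} {T : LevyTriple D}
    (hT : ∀ u, Tendsto (fun n => (Ts n).exponent u) atTop (𝓝 (T.exponent u)))
    (h : EuclideanSpace ℝ (Fin D)) (F : EuclideanSpace ℝ (Fin D) →ᵇ ℝ) :
    Tendsto (fun n => ∫ y, F y ∂((Ts n).differenceMeasure h)) atTop
      (𝓝 (∫ y, F y ∂(T.differenceMeasure h))) := by
  have h1 := FiniteMeasure.tendsto_of_tendsto_charFun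
    (μs := fun n => ⟨(Ts n).differenceMeasure h, inferInstance⟩)
    (μ := ⟨T.differenceMeasure h, inferInstance⟩) fun u => by
      simp only [FiniteMeasure.toMeasure_mk, charFun_differenceMeasure]
      exact (hT u).sub (((hT _).add (hT _)).div_const 2)
  exact FiniteMeasure.tendsto_iff_forall_integral_tendsto.1 h1 F

/-- The condition `F 0 = 0` removes the Gaussian atom, leaving only the Lévy measure. -/
theorem integral_mul_cosWeight (T : LevyTriple D) (R : ℝ) (F : EuclideanSpace ℝ (Fin D) →ᵇ ℝ)
    (hF : F 0 = 0) :
    ∫ x, cosWeight R x.toVec * F x.toVec ∂T.μ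
      = ∑ j, ∫ y, F y ∂(T.differenceMeasure (frequencyVec R j)) := by
  have hc := PuncturedSpace.continuous_toVec (D := D)
  simp_rw [T.integral_differenceMeasure _ (F.integrable _), hF, smul_zero, zero_add, smul_eq_mul,
    cosWeight, Finset.sum_mul]
  refine integral_finsetSum _ fun j _ => ?_
  refine (T.integrable_one_sub_cos _).mul_bdd (c := ‖F‖)
    (F.continuous.comp hc).aestronglyMeasurable (ae_of_all _ fun x => F.norm_coe_le_norm _)

/-- A continuous function with bounded support in `ℝ^D ∖ {0}` is the product of a weight and of
a bounded continuous function on `ℝ^D` that vanishes at `0`. -/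
theorem exists_eq_cosWeight_mul (f : PuncturedSpace D →ᵇ ℝ)
    (hf : Bornology.IsBounded (tsupport f)) :
    ∃ (R : ℝ) (F : EuclideanSpace ℝ (Fin D) →ᵇ ℝ), F 0 = 0 ∧
      ∀ x : PuncturedSpace D, f x = cosWeight R x.toVec * F x.toVec := by
  obtain ⟨R, hR, hfR⟩ := PuncturedSpace.exists_bound_of_isBounded hf
  let ι := PuncturedSpace.toVec (D := D)
  have hι : IsOpenEmbedding ι := PuncturedSpace.isOpenEmbedding_toVec
  let F : EuclideanSpace ℝ (Fin D) → ℝ :=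
    Function.extend ι (fun x => f x / cosWeight R x.toVec) 0
  have hFι : ∀ x, F (ι x) = f x / cosWeight R x.toVec := fun x => hι.injective.extend_apply _ _ x
  have hF0 : ∀ y, y ∉ ι '' tsupport f → F y = 0 := fun y hy => by
    by_cases h : ∃ x, ι x = y
    · obtain ⟨x, rfl⟩ := h
      rw [hFι, image_eq_zero_of_notMem_tsupport fun hx => hy ⟨x, hx, rfl⟩, zero_div]
    · exact Function.extend_apply' _ _ _ h
  have hsub : ι '' tsupport f ⊆ {y | ‖y.ofLp‖ ≤ R ∧ R⁻¹ ≤ ‖y.ofLp‖} := by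
    rintro _ ⟨x, hx, rfl⟩
    exact hfR x hx
  have hn : Continuous fun y : EuclideanSpace ℝ (Fin D) => ‖y.ofLp‖ :=
    (PiLp.continuous_ofLp 2 _).norm
  have hcl : IsClosed {y : EuclideanSpace ℝ (Fin D) | ‖y.ofLp‖ ≤ R ∧ R⁻¹ ≤ ‖y.ofLp‖} :=
    (isClosed_le hn continuous_const).inter (isClosed_le continuous_const hn)
  have hcont : Continuous F := by
    refine continuous_iff_continuousAt.2 fun y => ?_
    -- On the closed shell the open embedding reduces continuity to that of a quotient with positive
    -- denominator; off it `F` vanishes locally.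
    by_cases hy : ‖y.ofLp‖ ≤ R ∧ R⁻¹ ≤ ‖y.ofLp‖
    · have hy0 : y ≠ 0 := by
        rintro rfl
        have := inv_pos.2 hR
        simp at hy
        linarith
      obtain ⟨x, rfl⟩ : ∃ x, ι x = y := ⟨⟨y, hy0⟩, rfl⟩
      rw [← hι.continuousAt_iff]
      have h1 : F ∘ ι = fun x => f x / cosWeight R x.toVec := funext hFι
      rw [h1]
      exact f.continuous.continuousAt.div
        ((continuous_cosWeight R).comp hι.continuous).continuousAt (cosWeight_pos x hy.1).ne'
    · have h1 : F =ᶠ[𝓝 y] fun _ => 0 := by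
        filter_upwards [hcl.isOpen_compl.mem_nhds hy] with z hz
        exact hF0 z fun h => hz (hsub h)
      exact continuousAt_const.congr h1.symm
  -- Compactness of the shell bounds `F` despite the division by the weight.
  have hcs : HasCompactSupport F := by
    refine HasCompactSupport.intro'
      (K := {y : EuclideanSpace ℝ (Fin D) | ‖y.ofLp‖ ≤ R ∧ R⁻¹ ≤ ‖y.ofLp‖}) ?_ hcl
      fun y hy => hF0 y fun h => hy (hsub h)
    have h1 := (PiLp.homeomorph 2 (fun _ : Fin D => ℝ)).isCompact_preimage.2
      (isCompact_closedBall (0 : Fin D → ℝ) R)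
    refine h1.of_isClosed_subset hcl fun y hy => ?_
    exact mem_closedBall_zero_iff.2 hy.1
  obtain ⟨M, hM⟩ := hcont.bounded_above_of_compact_support hcs
  refine ⟨R, BoundedContinuousFunction.ofNormedAddCommGroup F hcont M hM, ?_, fun x => ?_⟩
  · refine hF0 0 ?_
    rintro ⟨x, -, hx⟩
    exact x.toVec_ne_zero hx
  · change f x = cosWeight R x.toVec * F (ι x)
    rw [hFι]
    by_cases hx : x ∈ tsupport f
    · rw [mul_div_cancel₀ _ (cosWeight_pos x (hfR x hx).1).ne']
    · rw [image_eq_zero_of_notMem_tsupport hx, zero_div, mul_zero]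

theorem weakHashTendsto_of_tendsto_exponent {Ts : ℕ → LevyTriple D} {T : LevyTriple D}
    (hT : ∀ u, Tendsto (fun n => (Ts n).exponent u) atTop (𝓝 (T.exponent u))) :
    WeakHashTendsto (fun n => (Ts n).μ) T.μ := by
  intro f hf
  obtain ⟨R, F, hF0, hfF⟩ := exists_eq_cosWeight_mul f hf
  simp_rw [hfF, integral_mul_cosWeight _ R F hF0]
  exact tendsto_finsetSum _ fun j _ => tendsto_integral_differenceMeasure hT _ F

/-- Dividing by the weight recovers `μ` on each set `‖x‖_∞ ≤ R`. The argument uses `lintegral`,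
since the reciprocal weight is unbounded near the origin. -/
theorem levyMeasure_eq_of_exponent_eq {T₁ T₂ : LevyTriple D} (h : T₁.exponent = T₂.exponent) :
    T₁.μ = T₂.μ := by
  have hρ : ∀ v, T₁.differenceMeasure v = T₂.differenceMeasure v := fun v =>
    Measure.ext_of_charFun (funext fun u => by simp_rw [charFun_differenceMeasure, h])
  have hm := PuncturedSpace.measurableEmbedding_toVec (D := D)
  have hsum : ∀ (T : LevyTriple D) (R : ℝ) (F : EuclideanSpace ℝ (Fin D) → ℝ≥0∞), Measurable F →
      F 0 = 0 → ∫⁻ x, ENNReal.ofReal (cosWeight R x.toVec) * F x.toVec ∂T.μ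
        = ∑ j, ∫⁻ y, F y ∂(T.differenceMeasure (frequencyVec R j)) := by
    intro T R F hF hF0
    simp_rw [T.lintegral_differenceMeasure _ hF, hF0, mul_zero, zero_add, cosWeight,
      ENNReal.ofReal_sum_of_nonneg fun j _ => one_sub_cos_inner_nonneg _ _, Finset.sum_mul]
    exact lintegral_finsetSum _ fun j _ =>
      (measurable_ofReal_one_sub_cos _).mul (hF.comp hm.measurable)
  have hball : ∀ (R : ℝ) (A : Set (PuncturedSpace D)), MeasurableSet A →
      (∀ x ∈ A, x.supNorm ≤ R) → T₁.μ A = T₂.μ A := by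
    intro R A hA hAR
    let F : EuclideanSpace ℝ (Fin D) → ℝ≥0∞ :=
      (PuncturedSpace.toVec '' A).indicator fun y => (ENNReal.ofReal (cosWeight R y))⁻¹
    have hF : Measurable F := Measurable.indicator
      (continuous_cosWeight R).measurable.ennreal_ofReal.inv (hm.measurableSet_image.2 hA)
    have hF0 : F 0 = 0 := Set.indicator_of_notMem
      (by rintro ⟨x, -, hx⟩; exact x.toVec_ne_zero hx) _
    have hind : ∀ x, ENNReal.ofReal (cosWeight R x.toVec) * F x.toVec = A.indicator 1 x := by
      intro x
      by_cases hx : x ∈ A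
      · have hFx : F x.toVec = (ENNReal.ofReal (cosWeight R x.toVec))⁻¹ :=
          Set.indicator_of_mem (Set.mem_image_of_mem _ hx) _
        rw [Set.indicator_of_mem hx, hFx]
        exact ENNReal.mul_inv_cancel
          (ENNReal.ofReal_pos.2 (cosWeight_pos x (hAR x hx))).ne' ENNReal.ofReal_ne_top
      · have hFx : F x.toVec = 0 :=
          Set.indicator_of_notMem (by rwa [hm.injective.mem_set_image]) _
        rw [Set.indicator_of_notMem hx, hFx, mul_zero]
    rw [← lintegral_indicator_one hA, ← lintegral_indicator_one hA]
    simp_rw [← hind, hsum _ R F hF hF0, hρ]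
  ext A hA
  have hms := PuncturedSpace.continuous_supNorm (D := D).measurable
  have hmeas : ∀ n : ℕ, MeasurableSet {x : PuncturedSpace D | x.supNorm ≤ n} := fun n =>
    measurableSet_le hms measurable_const
  -- Continuity from below along these pieces needs no finiteness of `μ`.
  have hA' : A = ⋃ n : ℕ, A ∩ {x | x.supNorm ≤ n} := by
    rw [← Set.inter_iUnion, Set.inter_eq_left.2]
    exact fun x _ => Set.mem_iUnion.2 (exists_nat_ge x.supNorm)
  have hmono : Monotone fun n : ℕ => A ∩ {x : PuncturedSpace D | x.supNorm ≤ n} :=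
    fun m n hmn x hx => ⟨hx.1, le_trans (Set.mem_ofPred.1 hx.2) (Nat.cast_le.2 hmn)⟩
  rw [hA', hmono.measure_iUnion, hmono.measure_iUnion]
  exact iSup_congr fun n => hball n _ (hA.inter (hmeas n)) fun x hx => hx.2

theorem eq_of_exponent_eq {T₁ T₂ : LevyTriple D} (h : T₁.exponent = T₂.exponent) : T₁ = T₂ := by
  have hμ := levyMeasure_eq_of_exponent_eq h
  have hbC : ∀ u : EuclideanSpace ℝ (Fin D), (⟪u, T₁.b⟫ : ℝ) = ⟪u, T₂.b⟫ ∧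
      u.ofLp ⬝ᵥ (T₁.C *ᵥ u.ofLp) = u.ofLp ⬝ᵥ (T₂.C *ᵥ u.ofLp) := by
    intro u
    have h1 := congrFun h u
    rw [exponent_eq, exponent_eq, hμ, add_left_inj] at h1
    have h2 := congrArg Complex.re h1
    have h3 := congrArg Complex.im h1
    simp at h2 h3
    exact ⟨h3, h2⟩
  refine LevyTriple.ext (ext_inner_left ℝ fun u => (hbC u).1) ?_ hμ
  -- Polarization: symmetry of `C` lets its quadratic form determine every entry.
  have hq : ∀ (T : LevyTriple D) (i j : Fin D),
      T.C i j = ((Pi.single i 1 + Pi.single j 1) ⬝ᵥ (T.C *ᵥ (Pi.single i 1 + Pi.single j 1))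
        - Pi.single i 1 ⬝ᵥ (T.C *ᵥ Pi.single i 1)
        - Pi.single j 1 ⬝ᵥ (T.C *ᵥ Pi.single j 1)) / 2 := by
    intro T i j
    have hs : T.C j i = T.C i j := by simpa using T.posSemidef.isHermitian.apply i j
    simp [Matrix.mulVec_add, add_dotProduct, hs]
    ring
  ext i j
  rw [hq, hq, (hbC (WithLp.toLp 2 (Pi.single i 1 + Pi.single j 1))).2,
    (hbC (WithLp.toLp 2 (Pi.single i 1))).2, (hbC (WithLp.toLp 2 (Pi.single j 1))).2]

theorem tendsto_exponent_of_tendstoUniformly_exp {Ts : ℕ → LevyTriple D} {T : LevyTriple D}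
    (u : EuclideanSpace ℝ (Fin D))
    (h : TendstoUniformly (fun n (t : unitInterval) => Complex.exp ((Ts n).exponent ((t : ℝ) • u)))
      (fun t => Complex.exp (T.exponent ((t : ℝ) • u))) atTop) :
    Tendsto (fun n => (Ts n).exponent u) atTop (𝓝 (T.exponent u)) := by
  have hc : ∀ T : LevyTriple D, Continuous fun t : unitInterval => T.exponent ((t : ℝ) • u) :=
    fun T => T.continuous_exponent.comp (by fun_prop)
  simpa using tendsto_one_of_tendstoUniformly_exp (fun n => hc (Ts n)) (hc T) (by simp) (by simp) h

/-- The lifting argument applied to a constant sequence, with uniqueness of limits. -/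
theorem exponent_eq_of_exp_exponent_eq {T₁ T₂ : LevyTriple D}
    (h : ∀ u, Complex.exp (T₁.exponent u) = Complex.exp (T₂.exponent u)) :
    T₁.exponent = T₂.exponent := by
  ext u
  refine tendsto_nhds_unique tendsto_const_nhds
    (tendsto_exponent_of_tendstoUniformly_exp (Ts := fun _ => T₁) u ?_)
  simp_rw [h]
  exact fun U hU => Eventually.of_forall fun _ _ => refl_mem_uniformity hU

end LevyTriple

theorem proposition4 (D : ℕ) :
    -- the exponent determines the triple
    (∀ (Ψ : EuclideanSpace ℝ (Fin D) → ℂ) (T₁ T₂ : LevyTriple D),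
      (∀ u, Ψ u = T₁.exponent u) → (∀ u, Ψ u = T₂.exponent u) → T₁ = T₂) ∧
    -- a random vector has at most one triple
    (∀ {Ω : Type u} [MeasurableSpace Ω] (P : Measure Ω) [IsProbabilityMeasure P]
      (Z : Ω → EuclideanSpace ℝ (Fin D)), IsInfinitelyDivisible Z P →
      ∀ T₁ T₂ : LevyTriple D, T₁.IsTripleOf Z P → T₂.IsTripleOf Z P → T₁ = T₂) ∧
    -- convergence in distribution implies convergence of the Lévy measures
    (∀ {Ω : Type v} [MeasurableSpace Ω] (P : Measure Ω) [IsProbabilityMeasure P]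
      (Z : Ω → EuclideanSpace ℝ (Fin D))
      {Ωs : ℕ → Type w} [∀ n, MeasurableSpace (Ωs n)] (Ps : ∀ n, Measure (Ωs n))
      [∀ n, IsProbabilityMeasure (Ps n)] (Zs : ∀ n, Ωs n → EuclideanSpace ℝ (Fin D)),
      IsInfinitelyDivisible Z P → (∀ n, IsInfinitelyDivisible (Zs n) (Ps n)) →
      TendstoInDistribution Zs atTop Z Ps P →
      ∀ (T : LevyTriple D) (Ts : ℕ → LevyTriple D),
        T.IsTripleOf Z P → (∀ n, (Ts n).IsTripleOf (Zs n) (Ps n)) →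
        WeakHashTendsto (fun n => (Ts n).μ) T.μ) := by
  refine ⟨fun Ψ T₁ T₂ h₁ h₂ => ?_, fun P _ Z _ T₁ T₂ h₁ h₂ => ?_, ?_⟩
  · exact LevyTriple.eq_of_exponent_eq (funext fun u => (h₁ u).symm.trans (h₂ u))
  · exact LevyTriple.eq_of_exponent_eq
      (LevyTriple.exponent_eq_of_exp_exponent_eq fun u => (h₁ u).symm.trans (h₂ u))
  · intro Ω _ P _ Z Ωs _ Ps _ Zs _ _ hZ T Ts hT hTs
    have : IsProbabilityMeasure (P.map Z) := Measure.isProbabilityMeasure_map hZ.aemeasurable_limit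
    have : ∀ n, IsProbabilityMeasure ((Ps n).map (Zs n)) := fun n =>
      Measure.isProbabilityMeasure_map (hZ.forall_aemeasurable n)
    have hchar : ∀ u, Tendsto (fun n => charFun ((Ps n).map (Zs n)) u) atTop
        (𝓝 (charFun (P.map Z) u)) :=
      ProbabilityMeasure.tendsto_iff_tendsto_charFun.1 hZ.tendsto
    refine LevyTriple.weakHashTendsto_of_tendsto_exponent fun u =>
      LevyTriple.tendsto_exponent_of_tendstoUniformly_exp u ?_
    have h := tendstoUniformly_charFun_path (μs := fun n => (Ps n).map (Zs n)) hchar u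
    simpa only [hTs _ _, hT _] using h
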